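/- **Corollary (Coloured Radon theorem with tolerance).** Let $d \ge 2$ and $r \ge 0$ be integers, put $n = (r+1)d+1$, and let $F_1, \dots, F_n$ be pairs of points in $\mathbb{R}^d$, called colour classes. (The $2n$ points are regarded as labelled, so different classes may share points.) Call a set of these labelled points *colourful* if it contains exactly one point of each $F_j$. Then the $2n$ points can be split into two disjoint colourful sets $A_1 = \{x^1_1, \dots, x^1_n\}$ and $A_2 = \{x^2_1, \dots, x^2_n\}$, with $F_j = \{x^1_j, x^2_j\}$ for every $j$, such that for every set $C \subseteq \{1,\dots,n\}$ of exactly $r$ colour classes the convex hulls of what is left in $A_1$ and in $A_2$ intersect: $$\operatorname{conv}\{x^1_j : j \notin C\} \cap \operatorname{conv}\{x^2_j : j \notin C\} \neq \emptyset .$$ Moreover, they intersect with equal coefficients: for every such $C$ there are $\alpha_j \ge 0$ $(j \notin C)$ with $\sum_{j \notin C} \alpha_j = 1$ and $\sum_{j \notin C} \alpha_j x^1_j = \sum_{j \notin C} \alpha_j x^2_j$. -/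

import Mathlib

/- Colour classes are indexed by `ι`, and the points inside each class carry labels from `κ`; the
labelled point `(j, t)` is the `t`-th point of class `j`, and its position is `z j t`.  Working with
labelled points lets two classes share a point of the space. -/

/-- A set of labelled points is colourful if it has exactly one element of each colour class. -/
def IsColourful {ι κ : Type*} (A : Finset (ι × κ)) : Prop :=
  ∀ j : ι, ∃! t : κ, (j, t) ∈ A

/-- What is left of `A` after the colour classes in `C` have been removed. -/
def removeClasses {ι κ : Type*} [DecidableEq ι] (A : Finset (ι × κ)) (C : Finset ι) :
    Finset (ι × κ) :=
  A.filter fun p => p.1 ∉ C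

/-- The convex hull of the positions of the labelled points in `A`. -/
def colourHull {ι κ E : Type*} [AddCommGroup E] [Module ℝ E] (z : ι → κ → E)
    (A : Finset (ι × κ)) : Set E :=
  convexHull ℝ ((fun p : ι × κ => z p.1 p.2) '' (A : Set (ι × κ)))

/-- After removal of the classes in `C`, the convex hulls of the colourful sets `A` and `B` intersect
with equal coefficients: there are coefficients of a convex combination, one for each remaining
colour class, for which the combinations of the points of `A` and of `B` are the same point. -/
def MeetWithEqualCoefficients {ι κ E : Type*} [Fintype ι] [DecidableEq ι] [AddCommGroup E]
    [Module ℝ E] (z : ι → κ → E) (A B : Finset (ι × κ)) (C : Finset ι) : Prop :=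
  ∃ α : ι → ℝ, (∀ j ∉ C, 0 ≤ α j) ∧ ∑ j ∈ Finset.univ \ C, α j = 1 ∧
    ∑ p ∈ removeClasses A C, α p.1 • z p.1 p.2 = ∑ p ∈ removeClasses B C, α p.1 • z p.1 p.2

/-!
For signs `ε : ι → {1, -1}`, let the first colourful set pick `z j 0` or `z j 1` according to `ε j`,
and let the second be its complement. After the removal of `C`, the two hulls meet with equal
coefficients exactly when `0` is a convex combination of the vectors `ε j • (z j 0 - z j 1)`,
`j ∉ C`. So it suffices to sign more than `(r + 1) * d` vectors of a space of dimension at most `d`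
in such a way that `0` stays in the convex hull of the signed vectors when any `r` of them are
removed.

Among finitely many vectors there are linearly independent ones, indexed by `S`, and signs such that
`0` lies in the convex hull of the signed vectors of `S` together with any one of the others: each
of the others, up to sign, lies in the simplicial cone spanned by the signed vectors of `S`. This is
dual to Shannon's theorem that a hyperplane arrangement has a simplicial chamber. To find `S`, take
a vector `c` in the span of the given vectors, outside all proper subspaces spanned by some of them,
and a basic representation of `c` of maximal `ℓ¹` norm; if another vector had coefficients of the
wrong signs, exchanging it for a vector of `S` would increase the norm.

Now argue by induction on the number of removed vectors that has to be tolerated. Split off `S`,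
which has at most `d` elements, and sign the others by induction. The signs of `S` may be reversed
simultaneously, so they can be chosen to fit the signs of at least half of the others, which is more
than the number of removed vectors because `2 ≤ d`. If no vector of `S` is removed, then some
fitting vector survives and closes up the cone of `S`; otherwise fewer of the others are removed,
and the induction hypothesis applies to them.
-/

open Finset Module
open Finsupp (single linearCombination mem_support_iff notMem_support_iff
  mem_span_image_iff_linearCombination)

lemma exists_units_int_smul_eq_abs {G : Type*} [AddCommGroup G] [LinearOrder G] (x : G) :
    ∃ s : ℤˣ, s • x = |x| := by
  rcases abs_choice x with h | h
  · exact ⟨1, by rw [h, one_smul]⟩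
  · exact ⟨-1, by rw [h, Units.neg_smul, one_smul]⟩

section ImageConvexHull

variable {R ι E : Type*} [Ring R] [PartialOrder R] [AddCommGroup E] [Module R E] {v : ι → E}

lemma zero_mem_convexHull_image_units_smul {K : Set ι} (s : ℤˣ)
    (h : 0 ∈ convexHull R (v '' K)) : 0 ∈ convexHull R ((fun i => s • v i) '' K) := by
  rcases Int.units_eq_one_or s with rfl | rfl
  · simpa using h
  · have hneg : (fun i => (-1 : ℤˣ) • v i) '' K = -(v '' K) := by
      rw [← Set.image_neg_eq_neg, Set.image_image]
      simp only [Units.neg_smul, one_smul]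
    rw [hneg, convexHull_neg]
    simpa using h

lemma mem_convexHull_image_of_eqOn {v' : ι → E} {K L : Set ι} {x : E}
    (hx : x ∈ convexHull R (v '' K)) (hKL : K ⊆ L) (hv : Set.EqOn v v' K) :
    x ∈ convexHull R (v' '' L) :=
  convexHull_mono (hv.image_eq ▸ Set.image_mono hKL) hx

end ImageConvexHull

section ConvexHull

variable {𝕜 ι E : Type*} [Field 𝕜] [LinearOrder 𝕜] [IsStrictOrderedRing 𝕜] [AddCommGroup E]
  [Module 𝕜 E] {v : ι → E}

lemma mem_convexHull_image_finset {K : Finset ι} {x : E} :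
    x ∈ convexHull 𝕜 (v '' K) ↔
      ∃ w : ι → 𝕜, (∀ i ∈ K, 0 ≤ w i) ∧ ∑ i ∈ K, w i = 1 ∧ ∑ i ∈ K, w i • v i = x := by
  classical
  constructor
  · refine fun hx => convexHull_min (t := {x | ∃ w : ι → 𝕜, (∀ i ∈ K, 0 ≤ w i) ∧ ∑ i ∈ K, w i = 1 ∧
      ∑ i ∈ K, w i • v i = x}) ?_ ?_ hx
    · rintro _ ⟨i, hi, rfl⟩
      refine ⟨Pi.single i 1, fun j _ => ?_, ?_, ?_⟩
      · rw [Pi.single_apply]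
        split_ifs <;> simp
      · rw [sum_pi_single', if_pos (mem_coe.1 hi)]
      · simp [Pi.single_apply, mem_coe.1 hi]
    · rintro _ ⟨w, hw₀, hw₁, rfl⟩ _ ⟨w', hw'₀, hw'₁, rfl⟩ s t hs ht hst
      refine ⟨s • w + t • w', fun i hi => ?_, ?_, ?_⟩
      · exact add_nonneg (mul_nonneg hs (hw₀ i hi)) (mul_nonneg ht (hw'₀ i hi))
      · simp [sum_add_distrib, ← mul_sum, hw₁, hw'₁, hst]
      · simp [add_smul, mul_smul, sum_add_distrib, ← smul_sum]
  · rintro ⟨w, hw₀, hw₁, rfl⟩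
    exact (convex_convexHull 𝕜 _).sum_mem hw₀ hw₁ fun i hi =>
      subset_convexHull 𝕜 _ (Set.mem_image_of_mem v hi)

lemma zero_mem_convexHull_insert_neg_sum {K : Finset ι} {b : ι → 𝕜} (hb : ∀ i ∈ K, 0 ≤ b i) :
    0 ∈ convexHull 𝕜 (insert (-∑ i ∈ K, b i • v i) (v '' K)) := by
  have hmem := (insertNone K).centerMass_mem_convexHull (R := 𝕜) (w := fun o => o.elim 1 b)
    (z := fun o => o.elim (-∑ i ∈ K, b i • v i) v)
    (s := insert (-∑ i ∈ K, b i • v i) (v '' K)) ?_ ?_ ?_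
  · simpa [centerMass, sum_insertNone] using hmem
  · exact forall_mem_insertNone.2 ⟨zero_le_one, hb⟩
  · simpa [sum_insertNone] using add_pos_of_pos_of_nonneg one_pos (sum_nonneg hb)
  · exact forall_mem_insertNone.2 ⟨.inl rfl, fun i hi => .inr ⟨i, hi, rfl⟩⟩

end ConvexHull

lemma abs_add_sign_mul_le_abs_add {R : Type*} [Ring R] [LinearOrder R] [IsStrictOrderedRing R]
    (x u : R) : |x| + SignType.sign x * u ≤ |x + u| := by
  rcases lt_trichotomy x 0 with hx | rfl | hx
  · simpa [hx, abs_of_neg, add_comm] using neg_le_abs (x + u)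
  · simp
  · simpa [hx, abs_of_pos] using le_abs_self (x + u)

lemma sum_abs_lt_sum_abs_add_smul_single_sub {R ι : Type*} [CommRing R] [LinearOrder R]
    [IsStrictOrderedRing R] {J : Finset ι} {w a : ι →₀ R} {j : ι} {μ : R}
    (hj : j ∈ J) (hwj : w j = 0) (haj : a j = 0) (hμ : μ ≠ 0)
    (hsum : μ * ∑ i ∈ J, SignType.sign (w i) * a i ≤ 0) :
    ∑ i ∈ J, |w i| < ∑ i ∈ J, |(w + μ • (single j 1 - a) : ι →₀ R) i| := by
  classical
  have hterm : ∀ i ∈ J, |w i| - μ * (SignType.sign (w i) * a i) + (if i = j then |μ| else 0) ≤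
      |(w + μ • (single j 1 - a) : ι →₀ R) i| := by
    intro i _
    rcases eq_or_ne i j with rfl | hij
    · simp [hwj, haj]
    · calc |w i| - μ * (SignType.sign (w i) * a i) + (if i = j then |μ| else 0)
          = |w i| + SignType.sign (w i) * (-(μ * a i)) := by rw [if_neg hij]; ring
        _ ≤ |w i + -(μ * a i)| := abs_add_sign_mul_le_abs_add _ _
        _ = |(w + μ • (single j 1 - a) : ι →₀ R) i| := by simp [hij.symm]
  have hle := sum_le_sum hterm
  rw [sum_add_distrib, sum_sub_distrib, ← mul_sum, sum_ite_eq' J j, if_pos hj] at hle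
  linarith [abs_pos.2 hμ]

section VectorSpace

variable {𝕜 ι E : Type*} [DivisionRing 𝕜] [AddCommGroup E] [Module 𝕜 E] {y : ι → E} {c : E}

lemma exists_mem_forall_mem_imp_le [Infinite 𝕜] {κ : Type*} [Finite κ] (V : Submodule 𝕜 E)
    (p : κ → Submodule 𝕜 E) : ∃ v ∈ V, ∀ i, v ∈ p i → V ≤ p i := by
  by_contra! h
  choose i hi hVi using fun v : V => h v v.2
  have hcover : ⋃ j : {j // ¬V ≤ p j}, (((p j).comap V.subtype : Submodule 𝕜 V) : Set V) = .univ :=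
    Set.eq_univ_of_forall fun v => Set.mem_iUnion.2 ⟨⟨i v, hVi v⟩, hi v⟩
  obtain ⟨⟨j, hVj⟩, hj⟩ := Subspace.exists_eq_top_of_iUnion_eq_univ hcover
  exact hVj (Submodule.comap_subtype_eq_top.1 hj)

lemma exists_mem_span_forall_subset_mem_span_imp [Infinite 𝕜] (y : ι → E) (J : Finset ι) :
    ∃ c ∈ Submodule.span 𝕜 (y '' J), ∀ T ⊆ J, c ∈ Submodule.span 𝕜 (y '' T) →
      ∀ j ∈ J, y j ∈ Submodule.span 𝕜 (y '' T) := by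
  obtain ⟨c, hcJ, hc⟩ := exists_mem_forall_mem_imp_le (Submodule.span 𝕜 (y '' J))
    fun T : J.powerset => Submodule.span 𝕜 (y '' (T : Finset ι))
  exact ⟨c, hcJ, fun T hT hcT j hj => hc ⟨T, mem_powerset.2 hT⟩ hcT
    (Submodule.subset_span (Set.mem_image_of_mem y hj))⟩

/-- The family of coefficients `w` is a basic representation of `c` by the vectors `y i`: it
represents `c`, and the vectors which occur in it are linearly independent. These are the basic
solutions of the linear system `∑ i, w i • y i = c` in the sense of linear programming. -/
def IsBasicRepresentation (y : ι → E) (c : E) (w : ι →₀ 𝕜) : Prop :=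
  LinearIndepOn 𝕜 y (w.support : Set ι) ∧ linearCombination 𝕜 y w = c

lemma exists_isBasicRepresentation {s : Set ι} (hc : c ∈ Submodule.span 𝕜 (y '' s)) :
    ∃ w : ι →₀ 𝕜, ↑w.support ⊆ s ∧ IsBasicRepresentation y c w := by
  obtain ⟨b, hbs, -, hspan, hb⟩ :=
    exists_linearIndepOn_extension (linearIndepOn_empty 𝕜 y) (Set.empty_subset s)
  obtain ⟨w, hwb, hw⟩ := (mem_span_image_iff_linearCombination 𝕜).1 (Submodule.span_le.2 hspan hc)
  exact ⟨w, hwb.trans hbs, hb.mono hwb, hw⟩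

lemma finite_setOf_isBasicRepresentation (y : ι → E) (c : E) (J : Finset ι) :
    {w : ι →₀ 𝕜 | w.support ⊆ J ∧ IsBasicRepresentation y c w}.Finite := by
  refine Set.Finite.of_finite_image (f := Finsupp.support)
    (J.powerset.finite_toSet.subset ?_) fun w hw w' hw' hsupp => ?_
  · rintro _ ⟨w, hw, rfl⟩
    exact mem_coe.2 (mem_powerset.2 hw.1)
  · exact linearIndepOn_iffₛ.1 hw.2.1 w (Set.Subset.refl _) w' (coe_subset.2 hsupp.ge)
      (hw.2.2.trans hw'.2.2.symm)

lemma support_add_div_smul_single_sub_subset [DecidableEq ι] {w a : ι →₀ 𝕜}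
    (ha : a.support ⊆ w.support) (j : ι) {k : ι} (hk : a k ≠ 0) :
    (w + (w k / a k) • (single j 1 - a)).support ⊆ insert j (w.support.erase k) := by
  intro i hi
  by_contra h
  obtain ⟨hij, hi'⟩ : i ≠ j ∧ (i ≠ k → w i = 0) := by simpa using h
  apply mem_support_iff.1 hi
  rcases eq_or_ne i k with rfl | hik
  · simp [hij.symm, hk]
  · simp [hij.symm, hi' hik, notMem_support_iff.1 (mt (@ha i) (by simpa using hi' hik))]

lemma IsBasicRepresentation.pivot {w a : ι →₀ 𝕜} (hw : IsBasicRepresentation y c w)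
    (ha : a.support ⊆ w.support) {j k : ι} (haj : linearCombination 𝕜 y a = y j) (hk : a k ≠ 0) :
    IsBasicRepresentation y c (w + (w k / a k) • (single j 1 - a)) := by
  classical
  have hyj : y j ∉ Submodule.span 𝕜 (y '' ((w.support.erase k : Finset ι) : Set ι)) := by
    intro h
    obtain ⟨l, hl, hlj⟩ := (mem_span_image_iff_linearCombination 𝕜).1 h
    have hal : a = l := linearIndepOn_iffₛ.1 hw.1 a (coe_subset.2 ha) l
      (hl.trans (coe_subset.2 (erase_subset k _))) (haj.trans hlj.symm)
    exact notMem_erase k _ (hl (mem_coe.2 (mem_support_iff.2 (hal ▸ hk))))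
  refine ⟨((hw.1.mono (coe_subset.2 (erase_subset k _))).insert hyj).mono ?_, ?_⟩
  · simpa only [coe_insert] using
      coe_subset.2 (support_add_div_smul_single_sub_subset ha j hk)
  · simp [hw.2, haj]

end VectorSpace

section OrderedField

variable {𝕜 ι E : Type*} [Field 𝕜] [LinearOrder 𝕜] [AddCommGroup E] [Module 𝕜 E] {y : ι → E} {c : E}

/-- A basic representation of `c` of maximal `ℓ¹` norm among those that use only the vectors
`y i` with `i ∈ J`. -/
structure IsMaxBasicRepresentation (y : ι → E) (J : Finset ι) (c : E) (w : ι →₀ 𝕜) : Prop where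
  support_subset : w.support ⊆ J
  isBasicRepresentation : IsBasicRepresentation y c w
  sum_abs_le : ∀ w' : ι →₀ 𝕜, w'.support ⊆ J → IsBasicRepresentation y c w' →
    ∑ i ∈ J, |w' i| ≤ ∑ i ∈ J, |w i|

lemma exists_isMaxBasicRepresentation {J : Finset ι} (hc : c ∈ Submodule.span 𝕜 (y '' J)) :
    ∃ w : ι →₀ 𝕜, IsMaxBasicRepresentation y J c w := by
  obtain ⟨w₀, hw₀J, hw₀⟩ := exists_isBasicRepresentation hc
  obtain ⟨w, ⟨hwJ, hw⟩, hmax⟩ := Set.exists_max_image _ (fun w => ∑ i ∈ J, |w i|)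
    (finite_setOf_isBasicRepresentation y c J) ⟨w₀, coe_subset.1 hw₀J, hw₀⟩
  exact ⟨w, hwJ, hw, fun w' hw'J hw' => hmax w' ⟨hw'J, hw'⟩⟩

variable [IsStrictOrderedRing 𝕜]

lemma IsMaxBasicRepresentation.sum_sign_mul_pos {J : Finset ι} {w a : ι →₀ 𝕜}
    (hw : IsMaxBasicRepresentation y J c w) {j k : ι} (hjJ : j ∈ J) (hj : j ∉ w.support)
    (ha : a.support ⊆ w.support) (haj : linearCombination 𝕜 y a = y j) (hk : a k ≠ 0) :
    0 < (∑ i ∈ J, SignType.sign (w i) * a i) * (w k * a k) := by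
  classical
  by_contra! hnonpos
  have hwk : w k ≠ 0 := mem_support_iff.1 (ha (mem_support_iff.2 hk))
  have hsum : w k / a k * ∑ i ∈ J, SignType.sign (w i) * a i ≤ 0 := by
    have hdiv : w k / a k * ∑ i ∈ J, SignType.sign (w i) * a i =
        (∑ i ∈ J, SignType.sign (w i) * a i) * (w k * a k) / a k ^ 2 := by
      field_simp
    exact hdiv ▸ div_nonpos_of_nonpos_of_nonneg hnonpos (sq_nonneg _)
  have hlt := sum_abs_lt_sum_abs_add_smul_single_sub hjJ (notMem_support_iff.1 hj)
    (notMem_support_iff.1 (mt (@ha j) hj)) (div_ne_zero hwk hk) hsum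
  refine hlt.not_ge (hw.sum_abs_le _ ?_ (hw.isBasicRepresentation.pivot ha haj hk))
  exact (support_add_div_smul_single_sub_subset ha j hk).trans
    (insert_subset hjJ ((erase_subset k _).trans hw.support_subset))

lemma IsMaxBasicRepresentation.exists_units_smul_nonneg {J : Finset ι} {w a : ι →₀ 𝕜}
    (hw : IsMaxBasicRepresentation y J c w) {j : ι} (hjJ : j ∈ J) (hj : j ∉ w.support)
    (ha : a.support ⊆ w.support) (haj : linearCombination 𝕜 y a = y j) {σ : ι → ℤˣ}
    (hσ : ∀ i, σ i • w i = |w i|) : ∃ s : ℤˣ, ∀ i, 0 ≤ s • σ i • a i := by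
  obtain ⟨s, hs⟩ := exists_units_int_smul_eq_abs (∑ i ∈ J, SignType.sign (w i) * a i)
  refine ⟨s, fun i => ?_⟩
  rcases eq_or_ne (a i) 0 with hi | hi
  · simp [hi]
  have hpos := hw.sum_sign_mul_pos hjJ hj ha haj hi
  have hprod : |(∑ i ∈ J, SignType.sign (w i) * a i) * w i| * (s • σ i • a i) =
      (∑ i ∈ J, SignType.sign (w i) * a i) * (w i * a i) := by
    rw [abs_mul, ← hs, ← hσ]
    rcases Int.units_eq_one_or s with rfl | rfl <;>
      rcases Int.units_eq_one_or (σ i) with h | h <;>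
      simp [h, Units.neg_smul, mul_assoc]
  exact (pos_of_mul_pos_right (hprod ▸ hpos) (abs_nonneg _)).le

lemma IsMaxBasicRepresentation.exists_zero_mem_convexHull {J : Finset ι} {w : ι →₀ 𝕜}
    (hw : IsMaxBasicRepresentation y J c w) {σ : ι → ℤˣ} (hσ : ∀ i, σ i • w i = |w i|)
    {j : ι} (hjJ : j ∈ J) (hj : j ∉ w.support)
    (hyj : y j ∈ Submodule.span 𝕜 (y '' w.support)) :
    ∃ s : ℤˣ, 0 ∈ convexHull 𝕜 (insert (s • y j) ((fun i => σ i • y i) '' w.support)) := by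
  obtain ⟨a, ha, haj⟩ := (mem_span_image_iff_linearCombination 𝕜).1 hyj
  obtain ⟨s, hs⟩ := hw.exists_units_smul_nonneg hjJ hj (coe_subset.1 ha) haj hσ
  have hsum : ∑ i ∈ w.support, (s • σ i • a i) • σ i • y i = s • y j := by
    rw [← haj, Finsupp.linearCombination_apply_of_mem_supported 𝕜 ha, smul_sum]
    refine sum_congr rfl fun i _ => ?_
    rw [smul_assoc, smul_assoc, smul_comm (a i), smul_smul (σ i), Int.units_mul_self, one_smul]
  refine ⟨-s, ?_⟩
  rw [Units.neg_smul, ← hsum]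
  exact zero_mem_convexHull_insert_neg_sum fun i _ => hs i

end OrderedField

section SignedVectors

variable (𝕜 : Type*) {ι E : Type*} [Field 𝕜] [LinearOrder 𝕜] [IsStrictOrderedRing 𝕜]
  [AddCommGroup E] [Module 𝕜 E]

theorem exists_linearIndepOn_units_zero_mem_convexHull (y : ι → E) (J : Finset ι) :
    ∃ S ⊆ J, LinearIndepOn 𝕜 y (S : Set ι) ∧ ∃ σ : ι → ℤˣ, ∀ j ∈ J, j ∉ S →
      0 ∈ convexHull 𝕜 ((fun i => σ i • y i) '' insert j (S : Set ι)) := by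
  classical
  obtain ⟨c, hcJ, hc⟩ := exists_mem_span_forall_subset_mem_span_imp (𝕜 := 𝕜) y J
  obtain ⟨w, hw⟩ := exists_isMaxBasicRepresentation hcJ
  have hwJ := hw.support_subset
  have hyspan := hc w.support hwJ
    ((mem_span_image_iff_linearCombination 𝕜).2 ⟨w, Set.Subset.refl _, hw.isBasicRepresentation.2⟩)
  choose σ hσ using fun i => exists_units_int_smul_eq_abs (w i)
  choose! s hs using fun j (hj : j ∈ J ∧ j ∉ w.support) =>
    hw.exists_zero_mem_convexHull hσ hj.1 hj.2 (hyspan j hj.1)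
  refine ⟨w.support, hwJ, hw.isBasicRepresentation.1, w.support.piecewise σ s, fun j hjJ hj => ?_⟩
  have hS : (fun i => w.support.piecewise σ s i • y i) '' w.support =
      (fun i => σ i • y i) '' w.support :=
    Set.image_congr fun i hi => by rw [piecewise_eq_of_mem _ _ _ (mem_coe.1 hi)]
  rw [Set.image_insert_eq, hS, piecewise_eq_of_notMem _ _ _ hj]
  exact hs j ⟨hjJ, hj⟩

theorem exists_units_forall_zero_mem_convexHull_sdiff [FiniteDimensional 𝕜 E] {d : ℕ} (hd : 2 ≤ d)
    (hE : finrank 𝕜 E ≤ d) (y : ι → E) (t : ℕ) (J : Finset ι) (hJ : t * d < #J) :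
    ∃ ε : ι → ℤˣ, ∀ C : Finset ι, #C < t →
      0 ∈ convexHull 𝕜 ((fun i => ε i • y i) '' (J \ C : Set ι)) := by
  classical
  induction t generalizing J with
  | zero => exact ⟨1, by simp⟩
  | succ t ih =>
    obtain ⟨S, hSJ, hS, σ, hσ⟩ := exists_linearIndepOn_units_zero_mem_convexHull 𝕜 y J
    have hSd : #S ≤ d := by
      simpa using hS.linearIndependent.fintype_card_le_finrank.trans hE
    have hJS : t * d < #(J \ S) := by
      rw [card_sdiff_of_subset hSJ]
      lia
    obtain ⟨ε, hε⟩ := ih (J \ S) hJS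
    -- Replacing `σ` by `s • σ` preserves `hσ`; a majority vote over `J \ S` determines `s`.
    obtain ⟨s, -, hs⟩ : ∃ s ∈ univ, t < #{j ∈ J \ S | ε j * σ j = s} := by
      refine exists_lt_card_fiber_of_mul_lt_card_of_maps_to (fun _ _ => mem_univ _) ?_
      rw [card_univ, Fintype.card_units_int, mul_comm]
      exact (Nat.mul_le_mul_left t hd).trans_lt hJS
    refine ⟨S.piecewise (s • σ) ε, fun C hC => ?_⟩
    by_cases hCS : Disjoint C S
    · obtain ⟨j, hj, hjC⟩ := exists_mem_notMem_of_card_lt_card (hC.trans_le hs)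
      obtain ⟨hjJS, hjs⟩ := mem_filter.1 hj
      obtain ⟨hjJ, hjS⟩ := mem_sdiff.1 hjJS
      have hεj : ε j = s * σ j := by rw [← hjs, mul_assoc, Int.units_mul_self, mul_one]
      refine mem_convexHull_image_of_eqOn
        (zero_mem_convexHull_image_units_smul s (hσ j hjJ hjS)) ?_ ?_
      · exact Set.insert_subset ⟨hjJ, hjC⟩ fun i hi => ⟨hSJ hi, disjoint_right.1 hCS hi⟩
      · rintro i (rfl | hi)
        · simp [hjS, hεj, mul_smul]
        · simp [mem_coe.1 hi, mul_smul]
    · obtain ⟨k, hkC, hkS⟩ := not_disjoint_iff.1 hCS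
      have hCS_card : #(C \ S) < #C := card_lt_card
        ⟨sdiff_subset, fun h => (mem_sdiff.1 (h hkC)).2 hkS⟩
      refine mem_convexHull_image_of_eqOn (hε (C \ S) (by lia)) (fun i hi => ?_) fun i hi => ?_
      · exact ⟨(mem_sdiff.1 hi.1).1,
          fun hiC => hi.2 (mem_sdiff.2 ⟨hiC, (mem_sdiff.1 hi.1).2⟩)⟩
      · simp [(mem_sdiff.1 hi.1).2]

end SignedVectors

section Colourful

variable {ι κ E : Type*}

lemma IsColourful.sum_removeClasses [Fintype ι] [DecidableEq ι] {M : Type*} [AddCommMonoid M]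
    {A : Finset (ι × κ)} (hA : IsColourful A) (C : Finset ι) (f : ι → M) :
    ∑ p ∈ removeClasses A C, f p.1 = ∑ j ∈ univ \ C, f j := by
  refine sum_nbij Prod.fst ?_ ?_ ?_ fun _ _ => rfl
  · intro p hp
    simpa using (mem_filter.1 hp).2
  · rintro ⟨j, t⟩ hp ⟨j', t'⟩ hp' (rfl : j = j')
    exact congrArg (Prod.mk j) ((hA j).unique (mem_filter.1 hp).1 (mem_filter.1 hp').1)
  · intro j hj
    obtain ⟨t, ht, -⟩ := hA j
    exact ⟨(j, t), mem_filter.2 ⟨ht, (mem_sdiff.1 hj).2⟩, rfl⟩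

lemma MeetWithEqualCoefficients.nonempty_colourHull_inter [Fintype ι] [DecidableEq ι]
    [AddCommGroup E] [Module ℝ E] {z : ι → κ → E} {A B : Finset (ι × κ)} {C : Finset ι}
    (h : MeetWithEqualCoefficients z A B C) (hA : IsColourful A) (hB : IsColourful B) :
    (colourHull z (removeClasses A C) ∩ colourHull z (removeClasses B C)).Nonempty := by
  obtain ⟨α, hα₀, hα₁, hαAB⟩ := h
  have hmem : ∀ D : Finset (ι × κ), IsColourful D →
      ∑ p ∈ removeClasses D C, α p.1 • z p.1 p.2 ∈ colourHull z (removeClasses D C) :=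
    fun D hD => mem_convexHull_image_finset.2 ⟨fun p => α p.1,
      fun p hp => hα₀ p.1 (mem_filter.1 hp).2, (hD.sum_removeClasses C α).trans hα₁, rfl⟩
  exact ⟨_, hmem A hA, hαAB ▸ hmem B hB⟩

/-- The colourful set that picks the point with label `g j` from each class `j`. -/
def colourfulSet [Fintype ι] [DecidableEq ι] [DecidableEq κ] (g : ι → κ) : Finset (ι × κ) :=
  univ.image fun j => (j, g j)

variable [Fintype ι] [DecidableEq ι]

lemma mem_colourfulSet [DecidableEq κ] {g : ι → κ} {p : ι × κ} :
    p ∈ colourfulSet g ↔ g p.1 = p.2 := by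
  simp [colourfulSet, Prod.ext_iff]

lemma isColourful_colourfulSet [DecidableEq κ] (g : ι → κ) : IsColourful (colourfulSet g) :=
  fun j => ⟨g j, mem_colourfulSet.2 rfl, fun _ ht => (mem_colourfulSet.1 ht).symm⟩

lemma compl_colourfulSet (g : ι → Fin 2) :
    (colourfulSet g)ᶜ = colourfulSet fun j => (g j).rev := by
  ext ⟨j, t⟩
  simp only [mem_compl, mem_colourfulSet]
  generalize g j = u
  decide +revert

lemma sum_removeClasses_colourfulSet [DecidableEq κ] {M : Type*} [AddCommMonoid M] (g : ι → κ)
    (C : Finset ι) (f : ι × κ → M) :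
    ∑ p ∈ removeClasses (colourfulSet g) C, f p = ∑ j ∈ univ \ C, f (j, g j) := by
  rw [← (isColourful_colourfulSet g).sum_removeClasses C fun j => f (j, g j)]
  refine sum_congr rfl fun p hp => ?_
  rw [mem_colourfulSet.1 (mem_filter.1 hp).1]

variable [AddCommGroup E] [Module ℝ E]

lemma meetWithEqualCoefficients_colourfulSet_iff [DecidableEq κ] {z : ι → κ → E} {f g : ι → κ}
    {C : Finset ι} : MeetWithEqualCoefficients z (colourfulSet f) (colourfulSet g) C ↔
      0 ∈ convexHull ℝ ((fun j => z j (f j) - z j (g j)) '' (univ \ C : Finset ι)) := by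
  have hsum : ∀ (h : ι → κ) (α : ι → ℝ), ∑ p ∈ removeClasses (colourfulSet h) C, α p.1 • z p.1 p.2 =
      ∑ j ∈ univ \ C, α j • z j (h j) :=
    fun h α => sum_removeClasses_colourfulSet h C fun p => α p.1 • z p.1 p.2
  simp only [mem_convexHull_image_finset, MeetWithEqualCoefficients, hsum, smul_sub,
    sum_sub_distrib, sub_eq_zero, mem_sdiff, mem_univ, true_and]

lemma exists_fin_two_smul_sub_eq {G : Type*} [AddCommGroup G] (s : ℤˣ) :
    ∃ t : Fin 2, ∀ x : Fin 2 → G, s • (x 0 - x 1) = x t - x t.rev := by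
  rcases Int.units_eq_one_or s with rfl | rfl
  · exact ⟨0, fun x => one_smul _ _⟩
  · exact ⟨1, fun x => by rw [Units.neg_smul, one_smul, neg_sub]; rfl⟩

theorem mainTheorem3_general [FiniteDimensional ℝ E] {d r : ℕ} (hd : 2 ≤ d)
    (hE : finrank ℝ E ≤ d) (hι : (r + 1) * d + 1 ≤ Fintype.card ι) (z : ι → Fin 2 → E) :
    ∃ A₁ A₂ : Finset (ι × Fin 2),
      IsColourful A₁ ∧ IsColourful A₂ ∧ Disjoint A₁ A₂ ∧ A₁ ∪ A₂ = univ ∧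
      ∀ C : Finset ι, #C ≤ r →
        (colourHull z (removeClasses A₁ C) ∩ colourHull z (removeClasses A₂ C)).Nonempty ∧
        MeetWithEqualCoefficients z A₁ A₂ C := by
  obtain ⟨ε, hε⟩ := exists_units_forall_zero_mem_convexHull_sdiff ℝ hd hE
    (fun j => z j 0 - z j 1) (r + 1) univ hι
  choose g hg using fun j => exists_fin_two_smul_sub_eq (G := E) (ε j)
  have hA₁ : IsColourful (colourfulSet g) := isColourful_colourfulSet g
  have hA₂ : IsColourful (colourfulSet g)ᶜ := compl_colourfulSet g ▸ isColourful_colourfulSet _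
  refine ⟨_, _, hA₁, hA₂, disjoint_compl_right, union_compl _, fun C hC => ?_⟩
  have hmeet : MeetWithEqualCoefficients z (colourfulSet g) (colourfulSet g)ᶜ C := by
    rw [compl_colourfulSet, meetWithEqualCoefficients_colourfulSet_iff]
    simpa only [coe_sdiff, hg] using hε C (Nat.lt_succ_of_le hC)
  exact ⟨hmeet.nonempty_colourHull_inter hA₁ hA₂, hmeet⟩

end Colourful

theorem mainTheorem3 (d r : ℕ) (hd : 2 ≤ d)
    (z : Fin ((r + 1) * d + 1) → Fin 2 → EuclideanSpace ℝ (Fin d)) :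
    ∃ A₁ A₂ : Finset (Fin ((r + 1) * d + 1) × Fin 2),
      IsColourful A₁ ∧ IsColourful A₂ ∧ Disjoint A₁ A₂ ∧ A₁ ∪ A₂ = Finset.univ ∧
      ∀ C : Finset (Fin ((r + 1) * d + 1)), C.card = r →
        (colourHull z (removeClasses A₁ C) ∩ colourHull z (removeClasses A₂ C)).Nonempty ∧
        MeetWithEqualCoefficients z A₁ A₂ C := by
  obtain ⟨A₁, A₂, hA₁, hA₂, hdisj, hunion, hmeet⟩ :=
    mainTheorem3_general (r := r) hd finrank_euclideanSpace_fin.le (Fintype.card_fin _).ge z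
  exact ⟨A₁, A₂, hA₁, hA₂, hdisj, hunion, fun C hC => hmeet C hC.le⟩
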